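/- Let $m \ge 3$ be an odd integer, let $q = 3^m$, and let $n = q+1$. Let $\beta$ be a primitive $n$-th root of unity in an extension field of $\mathbb{F}_q$, and for an integer $i$ let $m_i(x)$ be the minimal polynomial of $\beta^i$ over $\mathbb{F}_q$. Let $\mathcal{C} = \mathcal{C}_{(q,\,q+1,\,3,\,4)}$ be the BCH code of length $n$, designed distance $3$ and offset $4$, that is, the cyclic code of length $n$ over $\mathbb{F}_q$ with generator polynomial $\operatorname{lcm}(m_4(x), m_5(x))$: $$\mathcal{C} = \{(c_0,\dots,c_{n-1}) \in \mathbb{F}_q^{n} : c_0 + c_1x + \cdots + c_{n-1}x^{n-1} \text{ lies in the ideal of } \mathbb{F}_q[x]/(x^n-1) \text{ generated by } \operatorname{lcm}(m_4(x), m_5(x))\}.$$ Then the Euclidean dual code $\mathcal{C}^{\perp} = \{d \in \mathbb{F}_q^n : \sum_{i} c_i d_i = 0 \text{ for all } c \in \mathcal{C}\}$ is an almost MDS (AMDS) code, i.e. its minimum Hamming distance equals its length minus its dimension, with parameters $[q+1, 4, q-3]$: it has length $q+1$, dimension $4$ over $\mathbb{F}_q$ and minimum Hamming distance $q-3$. 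-/

import Mathlib

open Polynomial

noncomputable section

/-- The residue class ring `F[x]/(x^n - 1)`. -/
abbrev CyclicRing (F : Type*) [Field F] (n : ℕ) : Type _ :=
  F[X] ⧸ Ideal.span {(X ^ n - 1 : F[X])}

/-- The `F`-linear map `F^n → F[x]/(x^n - 1)`,
`(c_0, ..., c_{n-1}) ↦ c_0 + c_1 x + ... + c_{n-1} x^{n-1}`. -/
def vecToCyclicRing (F : Type*) [Field F] (n : ℕ) : (Fin n → F) →ₗ[F] CyclicRing F n where
  toFun c := Ideal.Quotient.mk _ (∑ i : Fin n, C (c i) * X ^ (i : ℕ))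
  map_add' c d := by
    rw [← map_add, ← Finset.sum_add_distrib]
    simp only [Pi.add_apply, map_add, add_mul]
  map_smul' a c := by
    have h : (∑ i : Fin n, C ((a • c) i) * X ^ (i : ℕ) : F[X])
        = a • ∑ i : Fin n, C (c i) * X ^ (i : ℕ) := by
      simp only [Finset.smul_sum, Pi.smul_apply, smul_eq_mul, map_mul, smul_eq_C_mul, mul_assoc]
    rw [h]
    rfl

/-- The cyclic code of length `n` over `F` generated by `g`: the vectors whose image in
`F[x]/(x^n - 1)` lies in the ideal generated by the class of `g`. -/
def cyclicCode {F : Type*} [Field F] (n : ℕ) (g : F[X]) : Submodule F (Fin n → F) :=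
  Submodule.comap (vecToCyclicRing F n)
    ((Ideal.span {(Ideal.Quotient.mk _ g : CyclicRing F n)}).restrictScalars F)

/-- The polynomial `lcm (m_h, m_{h+1}, ..., m_{h+δ-2})`, where `m_i` is the minimal polynomial
over `F` of `β^i`. When `β` is an `n`-th root of unity, `m_i` depends only on `i` modulo `n`. -/
def bchGenerator (F : Type*) {K : Type*} [Field F] [Field K] [Algebra F K]
    (β : K) (δ h : ℕ) : F[X] :=
  letI : DecidableEq F := Classical.decEq F
  letI : NormalizedGCDMonoid F[X] := UniqueFactorizationMonoid.toNormalizedGCDMonoid F[X]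
  (Finset.range (δ - 1)).lcm fun i => minpoly F (β ^ (h + i))

/-- The BCH code of length `n`, designed distance `δ` and offset `h` over `F`, with respect
to a primitive `n`-th root of unity `β` in an extension of `F`. -/
def bchCode (F : Type*) {K : Type*} [Field F] [Field K] [Algebra F K]
    (β : K) (n δ h : ℕ) : Submodule F (Fin n → F) :=
  cyclicCode n (bchGenerator F β δ h)

/-- The Euclidean dual of a linear code. -/
def dualCode {F : Type*} [Field F] {n : ℕ} (𝒞 : Submodule F (Fin n → F)) :
    Submodule F (Fin n → F) where
  carrier := {d | ∀ c ∈ 𝒞, c ⬝ᵥ d = 0}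
  add_mem' {a b} ha hb c hc := by rw [dotProduct_add, ha c hc, hb c hc, add_zero]
  zero_mem' c _ := dotProduct_zero c
  smul_mem' a b hb c hc := by rw [dotProduct_smul, hb c hc, smul_zero]

/-- `d` is the minimum Hamming distance of the code `𝒞`: the smallest Hamming distance
between distinct codewords. (In particular such a pair of codewords exists.) -/
def IsMinDist {F : Type*} [Field F] [DecidableEq F] {n : ℕ}
    (𝒞 : Submodule F (Fin n → F)) (d : ℕ) : Prop :=
  IsLeast {e | ∃ a ∈ 𝒞, ∃ b ∈ 𝒞, a ≠ b ∧ hammingDist a b = e} d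

/-- `𝒞` is an `[n, k, d]` linear code. -/
def HasParameters {F : Type*} [Field F] [DecidableEq F] {n : ℕ}
    (𝒞 : Submodule F (Fin n → F)) (k d : ℕ) : Prop :=
  Module.finrank F 𝒞 = k ∧ IsMinDist 𝒞 d

/-- `𝒞` is almost MDS: its minimum distance is the length minus the dimension, `d = n - k`. -/
def IsAMDS {F : Type*} [Field F] [DecidableEq F] {n : ℕ}
    (𝒞 : Submodule F (Fin n → F)) : Prop :=
  ∃ d, IsMinDist 𝒞 d ∧ d + Module.finrank F 𝒞 = n

end

/-! With `x = β ^ i`, entry `i` of a dual word is `a x ^ 4 + b x ^ 5 + c x⁻¹ ^ 4 + d x⁻¹ ^ 5`, which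
vanishes iff `x ^ 9 * (b x + a) + (c x + d) = 0`. If `b d - a c ≠ 0`, the map `x ↦ x ^ 9` agrees on
the zeros with a Möbius map, so the cross ratio `l` of four zeros satisfies `l ^ 9 = l`. The zeros
also satisfy `x ^ q = x⁻¹`, another Möbius map, so `l ^ q = l`. As `m` is odd, `l` lies in the field
of three elements; distinct points exclude 0 and 1, so `l = -1`. Three zeros then determine the
fourth, and a nonzero dual word has at most four zeros (`card_le_four_of_forall_isRoot`). This gives
dimension 4 and weight at least `q + 1 - 4`. Equality holds for a word vanishing where `x ^ 4 = 1`,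
since `4 ∣ q + 1`. -/

/-- An element of an extension of a finite field `F` fixed by the `|F|`-power map lies in `F`. -/
theorem exists_algebraMap_eq_of_pow_card {F K : Type*} [Field F] [Fintype F] [Field K]
    [Algebra F K] {y : K} (hy : y ^ Fintype.card F = y) : ∃ a : F, algebraMap F K a = y := by
  classical
  by_contra! h
  have hinj := (algebraMap F K).injective
  have hmem : y ∉ Finset.univ.image (algebraMap F K) := by
    simpa using h
  have hsub : (insert y (Finset.univ.image (algebraMap F K))).val ⊆
      (X ^ Fintype.card F - X : K[X]).roots := by
    intro z hz
    rw [mem_roots (FiniteField.X_pow_card_sub_X_ne_zero K Fintype.one_lt_card)]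
    simp only [Finset.mem_val, Finset.mem_insert, Finset.mem_image, Finset.mem_univ,
      true_and] at hz
    rcases hz with rfl | ⟨a, rfl⟩
    · simp [hy]
    · simp [← map_pow, FiniteField.pow_card]
  have := card_le_degree_of_subset_roots hsub
  rw [FiniteField.X_pow_card_sub_X_natDegree_eq K Fintype.one_lt_card,
    Finset.card_insert_of_notMem hmem, Finset.card_image_of_injective _ hinj,
    Finset.card_univ] at this
  omega

/-! ### Cross ratios and zeros on the unit circle -/

theorem pow_three_pow_odd_of_pow_nine {K : Type*} [Monoid K] {z : K} (hz : z ^ 9 = z)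
    {m : ℕ} (hm : Odd m) : z ^ 3 ^ m = z ^ 3 := by
  obtain ⟨k, rfl⟩ := hm
  induction k with
  | zero => simp
  | succ k ih =>
    rw [show 2 * (k + 1) + 1 = 2 * k + 1 + 2 by ring, pow_add, pow_mul, ih, ← pow_mul,
      mul_comm, pow_mul]
    norm_num [hz]

/-- Four zeros of `b x ^ 10 + a x ^ 9 + c x + d` on the unit circle `x ^ 3 ^ m = x⁻¹`, `m` odd,
are harmonically conjugate. -/
theorem cross_ratio_eq_neg_one {K : Type*} [Field K] [CharP K 3] {m : ℕ} (hm : Odd m)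
    {a b c d x₁ x₂ x₃ x₄ : K} (hdet : b * d - a * c ≠ 0)
    (h0 : ∀ x ∈ [x₁, x₂, x₃, x₄], x ≠ 0)
    (hq : ∀ x ∈ [x₁, x₂, x₃, x₄], x ^ 3 ^ m = x⁻¹)
    (hz : ∀ x ∈ [x₁, x₂, x₃, x₄], x ^ 9 * (b * x + a) + (c * x + d) = 0)
    (h12 : x₁ ≠ x₂) (h13 : x₁ ≠ x₃) (h14 : x₁ ≠ x₄) (h23 : x₂ ≠ x₃) (h24 : x₂ ≠ x₄)
    (h34 : x₃ ≠ x₄) :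
    (x₁ - x₃) * (x₂ - x₄) = -((x₁ - x₄) * (x₂ - x₃)) := by
  have : Fact (Nat.Prime 3) := ⟨Nat.prime_three⟩
  have hne : ∀ x ∈ [x₁, x₂, x₃, x₄], b * x + a ≠ 0 := by
    intro x hx h
    have h1 := hz x hx
    rw [h, mul_zero, zero_add] at h1
    exact hdet (by linear_combination b * h1 - c * h)
  -- Each point contributes its own denominator; these cancel in a cross ratio, here and in `hqq`.
  have h9 : ∀ x ∈ [x₁, x₂, x₃, x₄], ∀ y ∈ [x₁, x₂, x₃, x₄],
      (x - y) ^ 9 = (b * d - a * c) * (x - y) / ((b * x + a) * (b * y + a)) := by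
    intro x hx y hy
    have e : (x - y) ^ 9 = x ^ 9 - y ^ 9 := by simpa using sub_pow_char_pow (p := 3) x y 2
    rw [eq_div_iff (mul_ne_zero (hne x hx) (hne y hy)), e]
    linear_combination (b * y + a) * hz x hx - (b * x + a) * hz y hy
  have hqq : ∀ x ∈ [x₁, x₂, x₃, x₄], ∀ y ∈ [x₁, x₂, x₃, x₄],
      (x - y) ^ 3 ^ m = - (x - y) / (x * y) := by
    intro x hx y hy
    have hx0 := h0 x hx
    have hy0 := h0 y hy
    rw [sub_pow_char_pow, hq x hx, hq y hy]
    field_simp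
    ring
  simp only [List.mem_cons, List.not_mem_nil, or_false, forall_eq_or_imp, forall_eq] at *
  obtain ⟨n1, n2, n3, n4⟩ := hne
  obtain ⟨z1, z2, z3, z4⟩ := h0
  obtain ⟨⟨-, -, p13, p14⟩, ⟨-, -, p23, p24⟩, -, -⟩ := h9
  obtain ⟨⟨-, -, q13, q14⟩, ⟨-, -, q23, q24⟩, -, -⟩ := hqq
  have s12 := sub_ne_zero.2 h12
  have s13 := sub_ne_zero.2 h13
  have s14 := sub_ne_zero.2 h14
  have s23 := sub_ne_zero.2 h23
  have s24 := sub_ne_zero.2 h24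
  have s34 := sub_ne_zero.2 h34
  set l : K := (x₁ - x₃) * (x₂ - x₄) / ((x₁ - x₄) * (x₂ - x₃)) with hl
  have l9 : l ^ 9 = l := by
    rw [hl, div_pow, mul_pow, mul_pow, p13, p14, p23, p24]
    field_simp
  have lq : l ^ 3 ^ m = l := by
    rw [hl, div_pow, mul_pow, mul_pow, q13, q14, q23, q24]
    field_simp
  rw [pow_three_pow_odd_of_pow_nine l9 hm] at lq
  have l0 : l ≠ 0 := by rw [hl]; positivity
  have l1 : l - 1 ≠ 0 := by
    have : l - 1 = (x₁ - x₂) * (x₃ - x₄) / ((x₁ - x₄) * (x₂ - x₃)) := by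
      rw [hl]; field_simp; ring
    rw [this]
    positivity
  have h : l * (l - 1) * (l + 1) = 0 := by linear_combination lq
  have h' : l = -1 := eq_neg_of_add_eq_zero_left ((mul_eq_zero.1 h).resolve_left (mul_ne_zero l0 l1))
  rw [hl, div_eq_iff (mul_ne_zero s14 s23)] at h'
  linear_combination h'

theorem card_le_four_of_forall_isRoot {K : Type*} [Field K] [CharP K 3] {m : ℕ} (hm : Odd m)
    {a b c d : K} (hne : ¬(a = 0 ∧ b = 0 ∧ c = 0 ∧ d = 0)) (S : Finset K)
    (h0 : ∀ x ∈ S, x ≠ 0) (hq : ∀ x ∈ S, x ^ 3 ^ m = x⁻¹)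
    (hz : ∀ x ∈ S, x ^ 9 * (b * x + a) + (c * x + d) = 0) : S.card ≤ 4 := by
  classical
  have : Fact (Nat.Prime 3) := ⟨Nat.prime_three⟩
  by_contra! hS
  obtain ⟨T, hTS, hT⟩ := Finset.exists_subset_card_eq (show 5 ≤ S.card by omega)
  let f : Fin 5 ≃ T := (T.equivFinOfCardEq hT).symm
  let x : Fin 5 → K := fun i => f i
  have hx : ∀ i, x i ∈ S := fun i => hTS (f i).2
  have hinj : ∀ i j, i ≠ j → x i ≠ x j := fun i j hij h => hij (f.injective (Subtype.ext h))
  have hsub : ∀ i j, i ≠ j → x i - x j ≠ 0 := fun i j hij => sub_ne_zero.2 (hinj i j hij)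
  by_cases hdet : b * d - a * c = 0
  -- Degenerate case: of any two zeros, one is a root of `b x + a`. Three zeros thus give two such
  -- roots, forcing `a = b = 0`, then `c = d = 0`.
  · have h9 : ∀ i j, (x i - x j) ^ 9 * ((b * x i + a) * (b * x j + a)) = 0 := by
      intro i j
      have e : (x i - x j) ^ 9 = x i ^ 9 - x j ^ 9 := by
        simpa using sub_pow_char_pow (p := 3) (x i) (x j) 2
      rw [e]
      linear_combination (b * x j + a) * hz _ (hx i) - (b * x i + a) * hz _ (hx j)
        + (x i - x j) * hdet
    have hpr : ∀ i j, i ≠ j → b * x i + a = 0 ∨ b * x j + a = 0 := fun i j hij =>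
      mul_eq_zero.1 ((mul_eq_zero.1 (h9 i j)).resolve_left (pow_ne_zero _ (hsub i j hij)))
    have key : ∀ i j, i ≠ j → b * x i + a = 0 → b * x j + a = 0 → False := by
      intro i j hij hi hj
      have hb : b = 0 := (mul_eq_zero.1 (show b * (x i - x j) = 0 by
        linear_combination hi - hj)).resolve_right (hsub i j hij)
      have ha : a = 0 := by simpa [hb] using hi
      have ei := hz _ (hx i)
      have ej := hz _ (hx j)
      simp only [ha, hb, zero_mul, add_zero, mul_zero, zero_add] at ei ej
      have hc : c = 0 := (mul_eq_zero.1 (show c * (x i - x j) = 0 by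
        linear_combination ei - ej)).resolve_right (hsub i j hij)
      exact hne ⟨ha, hb, hc, by simpa [hc] using ei⟩
    rcases hpr 0 1 (by decide) with h | h
    · rcases hpr 1 2 (by decide) with h' | h'
      · exact key 0 1 (by decide) h h'
      · exact key 0 2 (by decide) h h'
    · rcases hpr 0 2 (by decide) with h' | h'
      · exact key 1 0 (by decide) h h'
      · exact key 1 2 (by decide) h h'
  · have hc : ∀ k, k ≠ 0 → k ≠ 1 → k ≠ 2 →
        (x 0 - x 2) * (x 1 - x k) = -((x 0 - x k) * (x 1 - x 2)) := by
      intro k k0 k1 k2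
      have hmem : ∀ y ∈ [x 0, x 1, x 2, x k], y ∈ S := by
        simp [hx]
      exact cross_ratio_eq_neg_one hm hdet (fun y hy => h0 y (hmem y hy))
        (fun y hy => hq y (hmem y hy)) (fun y hy => hz y (hmem y hy))
        (hinj _ _ (by decide)) (hinj _ _ (by decide)) (hinj _ _ k0.symm)
        (hinj _ _ (by decide)) (hinj _ _ k1.symm) (hinj _ _ k2.symm)
    have e3 := hc 3 (by decide) (by decide) (by decide)
    have e4 := hc 4 (by decide) (by decide) (by decide)
    have h34 := hsub 3 4 (by decide)
    -- The harmonic relation is affine in the fourth point, so two solutions make its linear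
    -- coefficient vanish.
    have s1 : (x 0 - x 2) + (x 1 - x 2) = 0 :=
      (mul_eq_zero.1 (show (x 3 - x 4) * ((x 0 - x 2) + (x 1 - x 2)) = 0 by
        linear_combination e4 - e3)).resolve_left h34
    have s2 : (x 0 - x 2) * (x 1 - x 0) = 0 := by
      linear_combination e3 - (x 0 - x 3) * s1
    exact mul_ne_zero (hsub 0 2 (by decide)) (hsub 1 0 (by decide)) s2

/-! ### Parity checks and the dual code -/

theorem dvd_bchGenerator_three_iff {F K : Type*} [Field F] [Field K] [Algebra F K] (β : K)
    (h : ℕ) (p : F[X]) :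
    bchGenerator F β 3 h ∣ p ↔ aeval (β ^ h) p = 0 ∧ aeval (β ^ (h + 1)) p = 0 := by
  classical
  simp only [bchGenerator, Finset.lcm_dvd_iff, minpoly.dvd_iff]
  simp [Finset.range_add_one, and_comm]

/-- When `g` divides the modulus, reducing modulo `X ^ n - 1` does not affect divisibility by `g`.
-/
theorem mem_cyclicCode_iff {F : Type*} [Field F] {n : ℕ} {g : F[X]} (hg : g ∣ X ^ n - 1)
    (c : Fin n → F) : c ∈ cyclicCode n g ↔ g ∣ ∑ i : Fin n, C (c i) * X ^ (i : ℕ) := by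
  have h : c ∈ cyclicCode n g ↔ Ideal.Quotient.mk (Ideal.span {(X ^ n - 1 : F[X])})
      (∑ i : Fin n, C (c i) * X ^ (i : ℕ)) ∈
      Ideal.span {(Ideal.Quotient.mk (Ideal.span {(X ^ n - 1 : F[X])}) g)} := Iff.rfl
  rw [h, Ideal.mem_span_singleton]
  constructor
  · rintro ⟨r, hr⟩
    obtain ⟨r, rfl⟩ := Ideal.Quotient.mk_surjective r
    rw [← map_mul, Ideal.Quotient.eq, Ideal.mem_span_singleton] at hr
    exact (dvd_sub_left (Dvd.intro _ rfl)).1 (hg.trans hr)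
  · exact fun h => map_dvd _ h

theorem mem_bchCode_three_iff {F K : Type*} [Field F] [Field K] [Algebra F K] {β : K}
    {n : ℕ} (hβ : β ^ n = 1) (h : ℕ) (c : Fin n → F) :
    c ∈ bchCode F β n 3 h ↔ ∑ i : Fin n, algebraMap F K (c i) * (β ^ h) ^ (i : ℕ) = 0 ∧
      ∑ i : Fin n, algebraMap F K (c i) * (β ^ (h + 1)) ^ (i : ℕ) = 0 := by
  rw [bchCode, mem_cyclicCode_iff, dvd_bchGenerator_three_iff]
  · simp
  · rw [dvd_bchGenerator_three_iff]
    simp [← pow_mul, mul_comm _ n, pow_mul β n, hβ]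

/-- The dual of the code with parity check words `u` is spanned by `u`. -/
theorem dualCode_eq_span {F ι : Type*} [Field F] [Finite ι] {n : ℕ}
    {𝒞 : Submodule F (Fin n → F)} (u : ι → Fin n → F) (h : ∀ c, c ∈ 𝒞 ↔ ∀ j, c ⬝ᵥ u j = 0) :
    dualCode 𝒞 = Submodule.span F (Set.range u) := by
  apply le_antisymm
  · intro d hd
    let φ : (Fin n → F) →ₗ[F] Module.Dual F (Fin n → F) := dotProductBilin F F
    have hφ : φ d ∈ Submodule.span F (Set.range (φ ∘ u)) := by
      apply mem_span_of_iInf_ker_le_ker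
      intro c hc
      simp only [Submodule.mem_iInf, LinearMap.mem_ker, Function.comp_apply] at hc ⊢
      have : c ∈ 𝒞 := (h c).2 fun j => by rw [dotProduct_comm]; exact hc j
      exact (dotProduct_comm d c).trans (hd c this)
    rw [Set.range_comp, ← Submodule.map_span] at hφ
    obtain ⟨e, he, hed⟩ := hφ
    have : e = d := dotProduct_eq _ _ fun c => LinearMap.congr_fun hed c
    exact this ▸ he
  · rw [Submodule.span_le]
    rintro _ ⟨j, rfl⟩ c hc
    exact (h c).1 hc j

/-- The `3 ^ m`-power map swaps `β` and `β⁻¹`. It fixes the sums and negates the differences; the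
factor `β ^ 4 - β⁻¹ ^ 4`, also negated, brings the latter into `F`. -/
theorem exists_words {F K : Type*} [Field F] [Fintype F] [Field K] [Algebra F K] [CharP K 3]
    {m : ℕ} (hF : Fintype.card F = 3 ^ m) {β : K} (hβ : β ^ 3 ^ m = β⁻¹) (n : ℕ) :
    ∃ s t : ℕ → Fin n → F, ∀ (e : ℕ) (i : Fin n),
      algebraMap F K (s e i) = (β ^ e) ^ (i : ℕ) + (β⁻¹ ^ e) ^ (i : ℕ) ∧
      algebraMap F K (t e i) =
        (β ^ 4 - β⁻¹ ^ 4) * ((β ^ e) ^ (i : ℕ) - (β⁻¹ ^ e) ^ (i : ℕ)) := by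
  have : Fact (Nat.Prime 3) := ⟨Nat.prime_three⟩
  have hβ' : β⁻¹ ^ 3 ^ m = β := by rw [inv_pow, hβ, inv_inv]
  have key : ∀ y : K, iterateFrobenius K 3 m y = y → ∃ a : F, algebraMap F K a = y := by
    intro y hy
    apply exists_algebraMap_eq_of_pow_card
    rwa [hF, ← iterateFrobenius_def]
  have hf : iterateFrobenius K 3 m β = β⁻¹ := hβ
  have hf' : iterateFrobenius K 3 m β⁻¹ = β := hβ'
  have hs : ∀ (e : ℕ) (i : Fin n), ∃ a : F,
      algebraMap F K a = (β ^ e) ^ (i : ℕ) + (β⁻¹ ^ e) ^ (i : ℕ) := by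
    intro e i
    apply key
    simp only [map_add, map_pow, hf, hf']
    ring
  have ht : ∀ (e : ℕ) (i : Fin n), ∃ a : F, algebraMap F K a =
      (β ^ 4 - β⁻¹ ^ 4) * ((β ^ e) ^ (i : ℕ) - (β⁻¹ ^ e) ^ (i : ℕ)) := by
    intro e i
    apply key
    simp only [map_sub, map_mul, map_pow, hf, hf']
    ring
  choose s hs using hs
  choose t ht using ht
  exact ⟨s, t, fun e i => ⟨hs e i, ht e i⟩⟩

/-- Over `F`, vanishing at `γ` amounts to orthogonality to the words `γ ^ i + γ⁻¹ ^ i` and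
`w * (γ ^ i - γ⁻¹ ^ i)`. -/
theorem sum_mul_pow_eq_zero_iff {F K : Type*} [Field F] [Fintype F] [Field K] [Algebra F K]
    [CharP K 3] {m n : ℕ} (hF : Fintype.card F = 3 ^ m) {γ w : K} (hγ : γ ^ 3 ^ m = γ⁻¹)
    (hw : w ≠ 0) {s t : Fin n → F}
    (hs : ∀ i, algebraMap F K (s i) = γ ^ (i : ℕ) + γ⁻¹ ^ (i : ℕ))
    (ht : ∀ i, algebraMap F K (t i) = w * (γ ^ (i : ℕ) - γ⁻¹ ^ (i : ℕ))) (c : Fin n → F) :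
    ∑ i : Fin n, algebraMap F K (c i) * γ ^ (i : ℕ) = 0 ↔ c ⬝ᵥ s = 0 ∧ c ⬝ᵥ t = 0 := by
  have : Fact (Nat.Prime 3) := ⟨Nat.prime_three⟩
  set P : K := ∑ i : Fin n, algebraMap F K (c i) * γ ^ (i : ℕ) with hP
  set M : K := ∑ i : Fin n, algebraMap F K (c i) * γ⁻¹ ^ (i : ℕ) with hM
  have hf : iterateFrobenius K 3 m γ = γ⁻¹ := hγ
  have hPM : P ^ 3 ^ m = M := by
    rw [← iterateFrobenius_def, hP, hM, map_sum]
    refine Finset.sum_congr rfl fun i _ => ?_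
    rw [map_mul, map_pow, hf, iterateFrobenius_def, ← map_pow, ← hF, FiniteField.pow_card]
  have hcs : algebraMap F K (c ⬝ᵥ s) = P + M := by
    simp only [dotProduct, map_sum, map_mul, hs, hP, hM, mul_add, Finset.sum_add_distrib]
  have hct : algebraMap F K (c ⬝ᵥ t) = w * (P - M) := by
    simp only [dotProduct, map_sum, map_mul, ht, hP, hM, ← Finset.sum_sub_distrib,
      Finset.mul_sum]
    exact Finset.sum_congr rfl fun i _ => by ring
  have h3 : (3 : K) = 0 := by exact_mod_cast CharP.cast_eq_zero K 3
  rw [← map_eq_zero (algebraMap F K) (a := c ⬝ᵥ s), ← map_eq_zero (algebraMap F K) (a := c ⬝ᵥ t),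
    hcs, hct]
  constructor
  -- The conjugate sum `M` is a power of `P`, so it vanishes with `P`.
  · intro h
    rw [← hPM, h, zero_pow (by positivity)]
    simp
  · rintro ⟨h1, h2⟩
    have h2 := (mul_eq_zero.1 h2).resolve_left hw
    linear_combination P * h3 - h1 - h2

/-- A nonzero word in the span of the parity checks has at most four zeros. -/
theorem card_zeros_le_four {F K : Type*} [Field F] [DecidableEq F] [Field K] [Algebra F K]
    [CharP K 3] {m n : ℕ} (hm : Odd m) {β w : K} (hβ : β ^ 3 ^ m = β⁻¹)
    (hprim : IsPrimitiveRoot β n) (hw : w ≠ 0) {s t s' t' : Fin n → F}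
    (hs : ∀ i, algebraMap F K (s i) = (β ^ 4) ^ (i : ℕ) + (β⁻¹ ^ 4) ^ (i : ℕ))
    (ht : ∀ i, algebraMap F K (t i) = w * ((β ^ 4) ^ (i : ℕ) - (β⁻¹ ^ 4) ^ (i : ℕ)))
    (hs' : ∀ i, algebraMap F K (s' i) = (β ^ 5) ^ (i : ℕ) + (β⁻¹ ^ 5) ^ (i : ℕ))
    (ht' : ∀ i, algebraMap F K (t' i) = w * ((β ^ 5) ^ (i : ℕ) - (β⁻¹ ^ 5) ^ (i : ℕ)))
    {α : Fin 4 → F} (hα : α ≠ 0) :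
    (Finset.univ.filter fun i => (∑ j, α j • ![s, t, s', t'] j) i = 0).card ≤ 4 := by
  classical
  have h3 : (3 : K) = 0 := by exact_mod_cast CharP.cast_eq_zero K 3
  have hinj := (algebraMap F K).injective
  set a : Fin 4 → K := fun j => algebraMap F K (α j) with ha
  rcases Nat.eq_zero_or_pos n with rfl | hn
  · simp
  have hβ0 : β ≠ 0 := hprim.ne_zero hn.ne'
  rw [← Finset.card_image_of_injective (f := fun i : Fin n => β ^ (i : ℕ)) _
    fun i j hij => Fin.ext (hprim.pow_inj i.2 j.2 hij)]
  refine card_le_four_of_forall_isRoot hm (a := a 0 + w * a 1) (b := a 2 + w * a 3)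
    (c := a 0 - w * a 1) (d := a 2 - w * a 3) ?_ _ ?_ ?_ ?_
  · rintro ⟨e1, e2, e3, e4⟩
    apply hα
    have key : ∀ u v : K, u + w * v = 0 → u - w * v = 0 → u = 0 ∧ v = 0 := by
      intro u v h1 h2
      have hu : u = 0 := by linear_combination u * h3 - h1 - h2
      refine ⟨hu, ?_⟩
      rw [hu, zero_add] at h1
      exact (mul_eq_zero.1 h1).resolve_left hw
    obtain ⟨a0, a1⟩ := key _ _ e1 e3
    obtain ⟨a2, a3⟩ := key _ _ e2 e4
    funext j
    apply hinj
    rw [Pi.zero_apply, map_zero]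
    fin_cases j
    exacts [a0, a1, a2, a3]
  · simp only [Finset.mem_image]
    rintro _ ⟨i, -, rfl⟩
    exact pow_ne_zero _ hβ0
  · simp only [Finset.mem_image]
    rintro _ ⟨i, -, rfl⟩
    rw [← pow_mul, mul_comm, pow_mul, hβ, inv_pow]
  · simp only [Finset.mem_image, Finset.mem_filter, Finset.mem_univ, true_and]
    rintro _ ⟨i, hi, rfl⟩
    have hi := congrArg (algebraMap F K) hi
    simp only [Fin.sum_univ_four, Pi.add_apply, Pi.smul_apply, smul_eq_mul, Matrix.cons_val,
      map_add, map_mul, map_zero, hs, ht, hs', ht', ← pow_mul] at hi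
    rw [mul_comm 4, mul_comm 5] at hi
    simp only [pow_mul, inv_pow] at hi
    have hx : β ^ (i : ℕ) ≠ 0 := pow_ne_zero _ hβ0
    generalize β ^ (i : ℕ) = x at hi hx
    change a 0 * _ + a 1 * _ + a 2 * _ + a 3 * _ = 0 at hi
    field_simp at hi
    -- Clearing denominators amounts to multiplying by `x ^ 5`.
    linear_combination hi

/-! ### Dimension and minimum distance -/

theorem theorem1p2 {F K : Type*} [Field F] [Fintype F] [DecidableEq F] [Field K] [Algebra F K]
    (m q : ℕ) (hm : 3 ≤ m) (hodd : Odd m) (hq : q = 3 ^ m) (hF : Fintype.card F = q)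
    (β : K) (hβ : IsPrimitiveRoot β (q + 1)) :
    IsAMDS (dualCode (bchCode F β (q + 1) 3 4)) ∧
      HasParameters (dualCode (bchCode F β (q + 1) 3 4)) 4 (q - 3) := by
  have : Fact (Nat.Prime 3) := ⟨Nat.prime_three⟩
  have hq27 : 27 ≤ q := hq ▸ Nat.pow_le_pow_right (n := 3) (by norm_num) hm
  have : CharP F 3 := charP_of_card_eq_prime_pow (hF.trans hq)
  have : CharP K 3 := charP_of_injective_algebraMap (algebraMap F K).injective 3
  have hβ0 : β ≠ 0 := hβ.ne_zero (by omega)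
  have hinv : β ^ 3 ^ m = β⁻¹ := by
    rw [← hq]
    exact eq_inv_of_mul_eq_one_left (by rw [← pow_succ, hβ.pow_eq_one])
  have hF' := hF.trans hq
  have hw : β ^ 4 - β⁻¹ ^ 4 ≠ 0 := by
    intro h
    have h8 : β ^ 8 = 1 := by
      field_simp at h
      linear_combination h
    exact absurd (Nat.le_of_dvd (by norm_num) (hβ.dvd_of_pow_eq_one _ h8)) (by omega)
  obtain ⟨s, t, hst⟩ := exists_words hF' hinv (q + 1)
  set u : Fin 4 → Fin (q + 1) → F := ![s 4, t 4, s 5, t 5] with hu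
  have hγ : ∀ e, (β ^ e) ^ 3 ^ m = (β ^ e)⁻¹ := fun e => by
    rw [← pow_mul, mul_comm, pow_mul, hinv, inv_pow]
  have hspan : dualCode (bchCode F β (q + 1) 3 4) = Submodule.span F (Set.range u) := by
    apply dualCode_eq_span
    intro c
    rw [mem_bchCode_three_iff hβ.pow_eq_one,
      sum_mul_pow_eq_zero_iff hF' (hγ 4) hw (fun i => by rw [← inv_pow]; exact (hst 4 i).1)
        (fun i => by rw [← inv_pow]; exact (hst 4 i).2),
      sum_mul_pow_eq_zero_iff hF' (hγ 5) hw (fun i => by rw [← inv_pow]; exact (hst 5 i).1)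
        (fun i => by rw [← inv_pow]; exact (hst 5 i).2)]
    simp [Fin.forall_fin_succ, hu, and_assoc]
  have hzeros : ∀ {α : Fin 4 → F}, α ≠ 0 →
      (Finset.univ.filter fun i => (∑ j, α j • u j) i = 0).card ≤ 4 := fun hα =>
    card_zeros_le_four hodd hinv hβ hw (fun i => (hst 4 i).1) (fun i => (hst 4 i).2)
      (fun i => (hst 5 i).1) (fun i => (hst 5 i).2) hα
  have hli : LinearIndependent F u := by
    rw [Fintype.linearIndependent_iff]
    intro α h
    by_contra! hne
    obtain ⟨j, hj⟩ := hne
    -- A vanishing nontrivial combination would have `q + 1 > 4` zeros.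
    have := hzeros (α := α) (fun h => hj (congrFun h j))
    simp only [h, Pi.zero_apply, Finset.filter_true, Finset.card_univ, Fintype.card_fin] at this
    omega
  have hrank : Module.finrank F (dualCode (bchCode F β (q + 1) 3 4)) = 4 := by
    rw [hspan, finrank_span_eq_card hli, Fintype.card_fin]
  have hsplit : ∀ d : Fin (q + 1) → F, (Finset.univ.filter fun i => d i = 0).card +
      hammingNorm d = q + 1 := fun d => by
    simpa [hammingNorm] using
      Finset.card_filter_add_card_filter_not (s := Finset.univ) fun i => d i = 0
  have hlow : ∀ d ∈ dualCode (bchCode F β (q + 1) 3 4), d ≠ 0 → q - 3 ≤ hammingNorm d := by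
    intro d hd hd0
    rw [hspan, Submodule.mem_span_range_iff_exists_fun] at hd
    obtain ⟨α, rfl⟩ := hd
    have h1 := hzeros (α := α) (fun h => hd0 (by simp [h]))
    have h2 := hsplit (∑ j, α j • u j)
    omega
  have hmin : IsMinDist (dualCode (bchCode F β (q + 1) 3 4)) (q - 3) := by
    have hmem : t 4 ∈ dualCode (bchCode F β (q + 1) 3 4) :=
      hspan ▸ Submodule.subset_span ⟨1, rfl⟩
    have hne : t 4 ≠ 0 := hli.ne_zero 1
    obtain ⟨k, hk⟩ : 4 ∣ q + 1 := by
      obtain ⟨r, rfl⟩ := hodd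
      have : 3 ^ (2 * r + 1) % 4 = 3 := by
        rw [pow_succ, pow_mul, Nat.mul_mod, Nat.pow_mod]
        norm_num
      rw [← hq] at this
      omega
    have hcard : 4 ≤ (Finset.univ.filter fun i => t 4 i = 0).card := by
      -- The indices `l * k` give the fourth roots of unity `β ^ (l * k)`, where `t 4` vanishes.
      let f : Fin 4 → Fin (q + 1) := fun l => ⟨l * k, by
        rw [hk]; exact Nat.mul_lt_mul_of_pos_right l.2 (by omega)⟩
      have hf : Function.Injective f := fun l l' h =>
        Fin.ext (Nat.eq_of_mul_eq_mul_right (by omega) (Fin.ext_iff.1 h))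
      have h4 : (Finset.univ.image f).card = 4 := by
        rw [Finset.card_image_of_injective _ hf, Finset.card_univ, Fintype.card_fin]
      refine h4.symm.trans_le <| Finset.card_le_card ?_
      intro i hi
      obtain ⟨l, -, rfl⟩ := Finset.mem_image.1 hi
      rw [Finset.mem_filter]
      refine ⟨Finset.mem_univ _, (algebraMap F K).injective ?_⟩
      have h1 : (β ^ 4) ^ ((l : ℕ) * k) = 1 := by
        rw [← pow_mul, show 4 * ((l : ℕ) * k) = (q + 1) * l by rw [hk]; ring, pow_mul,
          hβ.pow_eq_one, one_pow]
      rw [(hst 4 _).2, inv_pow, inv_pow, h1, inv_one, sub_self, mul_zero, map_zero]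
    refine ⟨⟨t 4, hmem, 0, Submodule.zero_mem _, hne, ?_⟩, ?_⟩
    · rw [hammingDist_zero_right]
      have := hsplit (t 4)
      have := hlow _ hmem hne
      omega
    · rintro _ ⟨x, hx, y, hy, hxy, rfl⟩
      rw [hammingDist_eq_hammingNorm]
      exact hlow _ (Submodule.add_mem _ (Submodule.neg_mem _ hx) hy)
        fun h => hxy (neg_add_eq_zero.1 h)
  exact ⟨⟨q - 3, hmin, by rw [hrank]; omega⟩, hrank, hmin⟩
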